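/- **Setting.** Let $\mathbb H^n$ be the Heisenberg group: $\mathbb R\times\mathbb R^n\times\mathbb R^n\ni(t,x,y)$ with the law $$(t,x,y)(t',x',y')=\bigl(t+t'+\tfrac12(y\cdot x'-x\cdot y'),\,x+x',\,y+y'\bigr)$$ and Haar measure $dt\,dx\,dy$; put $N=2n+1$. The left (right) convolution operator with kernel $k\in L^1(\mathbb H^n)$ is $K=(2\pi)^{-N/2}\int k(g)\,\pi_l(g)\,dg$ (resp. with $\pi_r$) on $L^2(\mathbb H^n)$, where $(\pi_l(g)f)(h)=f(g^{-1}h)$ and $(\pi_r(g)f)(h)=f(hg)$. Let $$\widehat k(\tau,q,p)=(2\pi)^{-N/2}\int k(t,x,y)\,e^{i(\tau t+q\cdot x+p\cdot y)}\,dt\,dx\,dy .$$ For $\hbar\in P=\mathbb R\setminus\{0\}$ let $\pi_\hbar$ be the Stone–von Neumann representation on $L^2(\mathbb R^n)$, $$\pi_{\hbar}(t,x,y)=e^{i(\hbar t+\operatorname{sgn}(\hbar)|\hbar|^{1/2}x\cdot X+|\hbar|^{1/2}y\cdot D)},\qquad X_ju(v)=v_ju(v),\quad D_j=\tfrac1i\tfrac{\partial}{\partial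 v_j},$$ and for a convolution $K$ with kernel $k$ let $\pi_\hbar(K)=(2\pi)^{-N/2}\int k(g)\pi_\hbar(g)\,dg=\widehat k(\hbar,\operatorname{sgn}(\hbar)|\hbar|^{1/2}X,|\hbar|^{1/2}D)$, the operator with Weyl symbol $(v,\xi)\mapsto\widehat k(\hbar,\operatorname{sgn}(\hbar)|\hbar|^{1/2}v,|\hbar|^{1/2}\xi)$. For $(q,p)$ in the phase space $M=\mathbb R^{2n}$ let $\pi_{(q,p)}(K)=\widehat k(0,q,p)\in\mathbb C$. The Jacobson topology on $P\cup M$ is generated by the sets $\{\pi:\pi(K)\ne0\}$, $k\in L^1(\mathbb H^n)$. The set of all pairs (representation $\pi$ in $P\cup M$, operator on the space of $\pi$) carries the coarsest topology in which the graph $\{(\pi,\pi(K))\}$ is closed for every $k\in L^1(\mathbb H^n)$; each map $\pi\mapsto(\pi,\pi(K))$ then induces the Jacobson topology on $P\cup M$. For operators $A_\hbar$ on $L^2(\mathbb R^n)$ and a function $f$ on $M$, $\lim_{\hbar\to0^+}A_\hbar=f$ means: for every $(q,p)\in M$ and $c\in\mathbb C$, the pair $((q,p),c)$ lies in the closure of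 $\{(\hbar,A_\hbar):0<\hbar\le\varepsilon\}$ for all $\varepsilon>0$ if and only if $c=f(q,p)$. The limit $\hbar\to0^-$ is defined likewise with $-\varepsilon\le\hbar<0$. For functions on $M$ put $$\{f,g\}=\sum_{j=1}^n\Bigl(\frac{\partial f}{\partial p_j}\frac{\partial g}{\partial q_j}-\frac{\partial f}{\partial q_j}\frac{\partial g}{\partial p_j}\Bigr).$$ **Proposition.** Let $K_1,K_2$ be convolutions (both left or both right) on $\mathbb H^n$ whose kernels $k_1,k_2\in L^1(\mathbb H^n)$ satisfy $\int(|x|+|y|)\,|k_j(t,x,y)|\,dt\,dx\,dy<\infty$. Then the functions $\widehat k_j(0,\cdot,\cdot)$ are $C^1$ on $\mathbb R^{2n}$. The commutator $[K_1,K_2]$ is the convolution whose kernel is the $L^1$ function $(2\pi)^{-N/2}(k_1*k_2-k_2*k_1)$, where $(k_1*k_2)(g)=\int k_1(h)k_2(h^{-1}g)\,dh$. Moreover $$\lim_{\hbar\to0^{\pm}}\frac i\hbar\,\pi_\hbar([K_1,K_2])=\{\widehat k_1(0,q,p),\widehat k_2(0,q,p)\}.$$ In addition, there is one convolution $B$ with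 kernel in $L^1(\mathbb H^n)$ such that $\pi_\hbar(B)=\frac i\hbar\pi_\hbar([K_1,K_2])$ for all $\hbar\ne0$ and $\pi_{(q,p)}(B)=\{\widehat k_1(0,q,p),\widehat k_2(0,q,p)\}$ for all $(q,p)$; and every point of $M$ lies in the Jacobson closure of $\{\pi_\hbar:0<\hbar\le\varepsilon\}$ and of $\{\pi_\hbar:-\varepsilon\le\hbar<0\}$ for every $\varepsilon>0$. -/

import Mathlib

open MeasureTheory Filter Topology

noncomputable section

namespace PlainMechanics

/-- The configuration space `ℝⁿ`. -/
abbrev V (n : ℕ) : Type := EuclideanSpace ℝ (Fin n)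

/-! ### The Heisenberg group -/

/-- The Heisenberg group `ℍⁿ` as a manifold: triples `(t, x, y)` with `t ∈ ℝ`, `x, y ∈ ℝⁿ`. Its Haar
measure is Lebesgue measure, i.e. `volume`. -/
abbrev Heis (n : ℕ) : Type := ℝ × V n × V n

/-- The group law `(t, x, y)(t', x', y') = (t + t' + (⟨y, x'⟩ - ⟨x, y'⟩) / 2, x + x', y + y')`.
Under `u = t`, `v = (x + i y) / 2` this is
`(u, v)(u', v') = (u + u' - 2 Im ∑ v'ₖ (conj vₖ), v + v')`. -/
def hmul {n : ℕ} (g h : Heis n) : Heis n :=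
  (g.1 + h.1 + (inner ℝ g.2.2 h.2.1 - inner ℝ g.2.1 h.2.2) / 2, g.2.1 + h.2.1, g.2.2 + h.2.2)

instance heisGroup (n : ℕ) : Group (Heis n) where
  mul := hmul
  one := ((0 : ℝ), (0 : V n), (0 : V n))
  inv g := (-g.1, -g.2.1, -g.2.2)
  mul_assoc a b c := by
    change hmul (hmul a b) c = hmul a (hmul b c)
    simp only [hmul, inner_add_left, inner_add_right, Prod.mk.injEq]
    refine ⟨by ring, by abel, by abel⟩
  one_mul a := by
    change hmul ((0 : ℝ), (0 : V n), (0 : V n)) a = a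
    simp [hmul]
  mul_one a := by
    change hmul a ((0 : ℝ), (0 : V n), (0 : V n)) = a
    simp [hmul]
  inv_mul_cancel a := by
    change hmul (-a.1, -a.2.1, -a.2.2) a = ((0 : ℝ), (0 : V n), (0 : V n))
    simp [hmul, real_inner_comm]

theorem heis_mul_def {n : ℕ} (g h : Heis n) : g * h =
    (g.1 + h.1 + (inner ℝ g.2.2 h.2.1 - inner ℝ g.2.1 h.2.2) / 2,
      g.2.1 + h.2.1, g.2.2 + h.2.2) := rfl

theorem heis_inv_def {n : ℕ} (g : Heis n) : g⁻¹ = (-g.1, -g.2.1, -g.2.2) := rfl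

theorem heis_one_def {n : ℕ} : (1 : Heis n) = ((0 : ℝ), (0 : V n), (0 : V n)) := rfl

theorem heis_continuous_mul (n : ℕ) : Continuous fun p : Heis n × Heis n => p.1 * p.2 := by
  simp only [heis_mul_def]
  fun_prop

theorem heis_continuous_inv (n : ℕ) : Continuous fun g : Heis n => g⁻¹ := by
  simp only [heis_inv_def]
  fun_prop

/-- Shears of `ℝ × ℝⁿ × ℝⁿ` over translations preserve Lebesgue measure. -/
theorem measurePreserving_shear {n : ℕ} (ℓ : V n × V n → ℝ) (hℓ : Continuous ℓ) (w : V n × V n) :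
    MeasurePreserving (fun h : Heis n => ((h.1 + ℓ h.2, h.2 + w) : Heis n)) volume volume := by
  have h1 : MeasurePreserving
      (fun p : (V n × V n) × ℝ => ((p.1 + w, p.2 + ℓ p.1) : (V n × V n) × ℝ))
      ((volume : Measure (V n × V n)).prod (volume : Measure ℝ))
      ((volume : Measure (V n × V n)).prod (volume : Measure ℝ)) := by
    refine MeasurePreserving.skew_product (g := fun p s => s + ℓ p)
      ((measurePreserving_add_right (volume : Measure (V n)) w.1).prod
        (measurePreserving_add_right (volume : Measure (V n)) w.2)) ?_ ?_
    · have : Continuous (Function.uncurry fun (p : V n × V n) (s : ℝ) => s + ℓ p) := by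
        fun_prop
      exact this.measurable
    · exact .of_forall fun p => (measurePreserving_add_right volume (ℓ p)).map_eq
  exact (Measure.measurePreserving_swap.comp h1).comp Measure.measurePreserving_swap

theorem measurePreserving_mul_left {n : ℕ} (g : Heis n) :
    MeasurePreserving (fun h : Heis n => g * h) volume volume := by
  convert measurePreserving_shear
    (fun p : V n × V n => g.1 + (inner ℝ g.2.2 p.1 - inner ℝ g.2.1 p.2) / 2) (by fun_prop) g.2
    using 2 with h
  simp only [heis_mul_def]
  ext1
  · ring
  · ext1 <;> simp [add_comm]

theorem measurePreserving_mul_right {n : ℕ} (g : Heis n) :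
    MeasurePreserving (fun h : Heis n => h * g) volume volume := by
  convert measurePreserving_shear
    (fun p : V n × V n => g.1 + (inner ℝ p.2 g.2.1 - inner ℝ p.1 g.2.2) / 2) (by fun_prop) g.2
    using 2 with h
  simp only [heis_mul_def]
  ext1
  · ring
  · ext1 <;> simp

/-! ### Unitary representations and their integrated forms -/

/-- A strongly continuous unitary representation of a topological group on a Hilbert space
(an isometric action of a group is by unitary operators). -/
structure UnitaryRep (G : Type*) [Group G] [TopologicalSpace G]
    (H : Type*) [NormedAddCommGroup H] [InnerProductSpace ℂ H] where
  op : G → H →L[ℂ] H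
  op_one : op 1 = 1
  op_mul : ∀ g h, op (g * h) = op g * op h
  norm_op : ∀ g u, ‖op g u‖ = ‖u‖
  continuous_op : ∀ u, Continuous fun g => op g u

/-- The space `L¹(ℍⁿ)` of convolution kernels. -/
abbrev Kernel (n : ℕ) : Type := Lp ℂ 1 (volume : Measure (Heis n))

/-- The normalizing constant `(2π)^{-N/2}`, `N = 2n + 1`. -/
def normConst (n : ℕ) : ℝ := (2 * Real.pi) ^ (-((2 * n + 1 : ℕ) : ℝ) / 2)

section Integrated

variable {n : ℕ} {H : Type*} [NormedAddCommGroup H] [InnerProductSpace ℂ H]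

theorem UnitaryRep.integrable_smul (π : UnitaryRep (Heis n) H) (k : Kernel n) (u : H) :
    Integrable (fun g : Heis n => k g • π.op g u) := by
  have hk : Integrable (k : Heis n → ℂ) := L1.integrable_coeFn k
  refine (hk.norm.mul_const ‖u‖).mono'
    (hk.aestronglyMeasurable.smul (π.continuous_op u).aestronglyMeasurable) ?_
  exact .of_forall fun g => by simp [norm_smul, π.norm_op]

/-- The operator `(2π)^{-N/2} ∫ k(g) π(g) dg` (strong integral) of a kernel `k ∈ L¹(ℍⁿ)` in a
unitary representation `π`. -/
def UnitaryRep.integrated (π : UnitaryRep (Heis n) H) (k : Kernel n) : H →L[ℂ] H :=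
  LinearMap.mkContinuous
    { toFun := fun u => (normConst n : ℂ) • ∫ g : Heis n, k g • π.op g u
      map_add' := fun u w => by
        rw [← smul_add, ← integral_add (π.integrable_smul k u) (π.integrable_smul k w)]
        simp [smul_add]
      map_smul' := fun c u => by
        simp only [map_smul, RingHom.id_apply]
        rw [smul_comm c, ← integral_smul c]
        simp only [smul_comm c] }
    (‖(normConst n : ℂ)‖ * ∫ g : Heis n, ‖k g‖) (fun u => by
      change ‖(normConst n : ℂ) • ∫ g : Heis n, k g • π.op g u‖ ≤ _
      rw [norm_smul, mul_assoc, ← integral_mul_const]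
      gcongr
      refine (norm_integral_le_integral_norm _).trans (le_of_eq ?_)
      simp [norm_smul, π.norm_op])

theorem UnitaryRep.integrated_apply (π : UnitaryRep (Heis n) H) (k : Kernel n) (u : H) :
    π.integrated k u = (normConst n : ℂ) • ∫ g : Heis n, k g • π.op g u := rfl

end Integrated

/-! ### Convolution operators -/

/-- `L²(ℍⁿ)`. -/
abbrev L2Heis (n : ℕ) : Type := Lp ℂ 2 (volume : Measure (Heis n))

/-- The left regular representation `(π_l(g) f)(h) = f(g⁻¹ h)` on `L²(ℍⁿ)`. -/
def leftRegular (n : ℕ) : UnitaryRep (Heis n) (L2Heis n) where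
  op g := (Lp.compMeasurePreservingₗᵢ ℂ (fun h : Heis n => g⁻¹ * h)
    (measurePreserving_mul_left g⁻¹)).toContinuousLinearMap
  op_one := by
    ext1 u
    apply Lp.ext
    refine (Lp.coeFn_compMeasurePreserving u (measurePreserving_mul_left (1 : Heis n)⁻¹)).trans ?_
    simp [Function.comp_def]
  op_mul g h := by
    ext1 u
    apply Lp.ext
    refine (Lp.coeFn_compMeasurePreserving u (measurePreserving_mul_left (g * h)⁻¹)).trans ?_
    refine .trans ?_ (Lp.coeFn_compMeasurePreserving _ (measurePreserving_mul_left g⁻¹)).symm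
    refine .trans ?_ ((measurePreserving_mul_left g⁻¹).quasiMeasurePreserving.ae_eq_comp
      (Lp.coeFn_compMeasurePreserving u (measurePreserving_mul_left h⁻¹))).symm
    simp [Function.comp_def, mul_assoc]
  norm_op g u := LinearIsometry.norm_map _ u
  continuous_op u := by
    have hc : Continuous fun p : Heis n × Heis n => p.1⁻¹ * p.2 :=
      (heis_continuous_mul n).comp
        (((heis_continuous_inv n).comp continuous_fst).prodMk continuous_snd)
    exact Continuous.compMeasurePreservingLp (f := fun _ : Heis n => u)
      (g := ContinuousMap.curry ⟨_, hc⟩) continuous_const (ContinuousMap.continuous _)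
      (fun g => measurePreserving_mul_left g⁻¹) (by norm_num)

/-- The right regular representation `(π_r(g) f)(h) = f(h g)` on `L²(ℍⁿ)`. -/
def rightRegular (n : ℕ) : UnitaryRep (Heis n) (L2Heis n) where
  op g := (Lp.compMeasurePreservingₗᵢ ℂ (fun h : Heis n => h * g)
    (measurePreserving_mul_right g)).toContinuousLinearMap
  op_one := by
    ext1 u
    apply Lp.ext
    refine (Lp.coeFn_compMeasurePreserving u (measurePreserving_mul_right (1 : Heis n))).trans ?_
    simp [Function.comp_def]
  op_mul g h := by
    ext1 u
    apply Lp.ext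
    refine (Lp.coeFn_compMeasurePreserving u (measurePreserving_mul_right (g * h))).trans ?_
    refine .trans ?_ (Lp.coeFn_compMeasurePreserving _ (measurePreserving_mul_right g)).symm
    refine .trans ?_ ((measurePreserving_mul_right g).quasiMeasurePreserving.ae_eq_comp
      (Lp.coeFn_compMeasurePreserving u (measurePreserving_mul_right h))).symm
    simp [Function.comp_def, mul_assoc]
  norm_op g u := LinearIsometry.norm_map _ u
  continuous_op u := by
    have hc : Continuous fun p : Heis n × Heis n => p.2 * p.1 :=
      (heis_continuous_mul n).comp (continuous_snd.prodMk continuous_fst)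
    exact Continuous.compMeasurePreservingLp (f := fun _ : Heis n => u)
      (g := ContinuousMap.curry ⟨_, hc⟩) continuous_const (ContinuousMap.continuous _)
      (fun g => measurePreserving_mul_right g) (by norm_num)

/-- The left convolution operator with kernel `k`. -/
def leftConv {n : ℕ} (k : Kernel n) : L2Heis n →L[ℂ] L2Heis n := (leftRegular n).integrated k

/-- The right convolution operator with kernel `k`. -/
def rightConv {n : ℕ} (k : Kernel n) : L2Heis n →L[ℂ] L2Heis n := (rightRegular n).integrated k

/-- Convolution of functions on `ℍⁿ`. -/
def groupConv {n : ℕ} (k₁ k₂ : Heis n → ℂ) (g : Heis n) : ℂ := ∫ h : Heis n, k₁ h * k₂ (h⁻¹ * g)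

/-- The kernel of the commutator of two convolution operators. -/
def commKernel {n : ℕ} (k₁ k₂ : Heis n → ℂ) (g : Heis n) : ℂ :=
  normConst n * (groupConv k₁ k₂ g - groupConv k₂ k₁ g)

/-! ### The Stone–von Neumann representations -/

/-- `L²(ℝⁿ)`. -/
abbrev L2 (n : ℕ) : Type := Lp ℂ 2 (volume : Measure (V n))

/-- The set `P = ℝ ∖ {0}` of Planck constants. -/
abbrev Planck : Type := {ħ : ℝ // ħ ≠ 0}

/-- `|ħ|^{1/2}`. -/
def rootAbs (ħ : Planck) : ℝ := Real.sqrt |ħ.1|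

/-- `sgn(ħ) |ħ|^{1/2}`. -/
def signedRoot (ħ : Planck) : ℝ := SignType.sign ħ.1 * Real.sqrt |ħ.1|

theorem signedRoot_mul_rootAbs (ħ : Planck) : signedRoot ħ * rootAbs ħ = ħ.1 := by
  rw [signedRoot, rootAbs, mul_assoc, Real.mul_self_sqrt (abs_nonneg _), sign_mul_abs]

/-- The phase `exp i(ħ t + sgn(ħ)|ħ|^{1/2} ⟨x, v⟩ + ħ ⟨x, y⟩ / 2)`. -/
def schPhase {n : ℕ} (ħ : Planck) (g : Heis n) (v : V n) : ℂ :=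
  Complex.exp (Complex.I * ((ħ.1 * g.1 + signedRoot ħ * inner ℝ g.2.1 v
    + ħ.1 * inner ℝ g.2.1 g.2.2 / 2 : ℝ) : ℂ))

theorem norm_schPhase {n : ℕ} (ħ : Planck) (g : Heis n) (v : V n) : ‖schPhase ħ g v‖ = 1 := by
  rw [schPhase, mul_comm, Complex.norm_exp_ofReal_mul_I]

theorem continuous_schPhase {n : ℕ} (ħ : Planck) :
    Continuous fun p : Heis n × V n => schPhase ħ p.1 p.2 := by
  unfold schPhase
  fun_prop

theorem memLp_phase_mul {n : ℕ} (ħ : Planck) (g : Heis n) (u : L2 n) :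
    MemLp (fun v => schPhase ħ g v * u v) 2 volume := by
  refine (Lp.memLp u).of_le (AEStronglyMeasurable.mul ?_ (Lp.aestronglyMeasurable u))
    (.of_forall fun v => by simp [norm_schPhase])
  exact ((continuous_schPhase ħ).comp (Continuous.prodMk_right g)).aestronglyMeasurable

/-- Multiplication of `L²(ℝⁿ)` by the phase. -/
def phaseMul {n : ℕ} (ħ : Planck) (g : Heis n) : L2 n →ₗᵢ[ℂ] L2 n where
  toFun u := (memLp_phase_mul ħ g u).toLp
  map_add' u w := by
    rw [← MemLp.toLp_add]
    refine MemLp.toLp_congr _ _ ?_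
    filter_upwards [Lp.coeFn_add u w] with v hv
    rw [hv]
    simp [mul_add]
  map_smul' c u := by
    rw [RingHom.id_apply, ← MemLp.toLp_const_smul]
    refine MemLp.toLp_congr _ _ ?_
    filter_upwards [Lp.coeFn_smul c u] with v hv
    simp [hv]
    ring
  norm_map' u := by
    change ‖(memLp_phase_mul ħ g u).toLp‖ = ‖u‖
    rw [Lp.norm_toLp, Lp.norm_def]
    congr 1
    exact eLpNorm_congr_norm_ae (.of_forall fun v => by simp [norm_schPhase])

theorem coeFn_phaseMul {n : ℕ} (ħ : Planck) (g : Heis n) (u : L2 n) :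
    phaseMul ħ g u =ᵐ[volume] fun v => schPhase ħ g v * u v :=
  MemLp.coeFn_toLp (memLp_phase_mul ħ g u)

theorem continuous_phaseMul {n : ℕ} (ħ : Planck) (u : L2 n) :
    Continuous fun g : Heis n => phaseMul ħ g u := by
  rw [continuous_iff_continuousAt]
  intro g₀
  have key : Tendsto (fun g : Heis n => ∫⁻ v : V n,
      ‖schPhase ħ g v * u v - schPhase ħ g₀ v * u v‖ₑ ^ (2 : ℝ)) (𝓝 g₀) (𝓝 (∫⁻ _ : V n, 0)) := by
    refine tendsto_lintegral_filter_of_dominated_convergence'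
      (fun v => (2 * ‖u v‖ₑ) ^ (2 : ℝ)) ?_ ?_ ?_ ?_
    · refine .of_forall fun g => ?_
      exact (((memLp_phase_mul ħ g u).sub
        (memLp_phase_mul ħ g₀ u)).aestronglyMeasurable.enorm).pow_const _
    · refine .of_forall fun g => .of_forall fun v => ?_
      gcongr
      refine (enorm_sub_le).trans (le_of_eq ?_)
      have h1 : ∀ g : Heis n, ‖schPhase ħ g v‖ₑ = 1 := fun g => by
        rw [← ofReal_norm, norm_schPhase, ENNReal.ofReal_one]
      simp [enorm_mul, h1, two_mul]
    · simp_rw [ENNReal.mul_rpow_of_nonneg _ _ (zero_le_two : (0 : ℝ) ≤ 2)]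
      rw [lintegral_const_mul' _ _ (by finiteness)]
      refine ENNReal.mul_ne_top (by finiteness) ?_
      have := lintegral_rpow_enorm_lt_top_of_eLpNorm_lt_top (two_ne_zero) (by norm_num)
        (Lp.memLp u).2
      simpa using this.ne
    · refine .of_forall fun v => ?_
      have h : Continuous fun g : Heis n =>
          ‖schPhase ħ g v * u v - schPhase ħ g₀ v * u v‖ₑ ^ (2 : ℝ) := by
        have h0 : Continuous fun g : Heis n => schPhase ħ g v :=
          (continuous_schPhase ħ).comp (continuous_id.prodMk continuous_const)
        fun_prop
      simpa using h.tendsto g₀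
  have h2 := (Lp.tendsto_Lp_iff_tendsto_eLpNorm'' (fi := 𝓝 g₀)
    (fun g v => schPhase ħ g v * u v) (fun g => memLp_phase_mul ħ g u)
    (fun v => schPhase ħ g₀ v * u v) (memLp_phase_mul ħ g₀ u)).2
  refine h2 ?_
  simp only [lintegral_zero] at key
  have h3 := key.ennrpow_const (1 / 2 : ℝ)
  simp only [one_div, ENNReal.zero_rpow_of_pos (show (0 : ℝ) < 2⁻¹ by norm_num)] at h3
  refine h3.congr fun g => ?_
  rw [eLpNorm_eq_lintegral_rpow_enorm_toReal (by norm_num) (by norm_num)]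
  simp

/-- For `ħ = ±λ`, `λ > 0`, the representation
`π_{±λ}(t, x, y) = exp i(±λ t ± λ^{1/2} x·X + λ^{1/2} y·D)` on `L²(ℝⁿ)`, where `Xⱼ` is
multiplication by `vⱼ` and `Dⱼ = -i ∂/∂vⱼ`; explicitly
`(π_ħ(t, x, y) u)(v) = exp i(ħ t + sgn(ħ)|ħ|^{1/2} ⟨x, v⟩ + ħ ⟨x, y⟩ / 2) u(v + |ħ|^{1/2} y)`. -/
def schrodinger (n : ℕ) (ħ : Planck) : UnitaryRep (Heis n) (L2 n) where
  op g := ((phaseMul ħ g).comp (Lp.compMeasurePreservingₗᵢ ℂ (fun v : V n => v + rootAbs ħ • g.2.2)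
    (measurePreserving_add_right volume (rootAbs ħ • g.2.2)))).toContinuousLinearMap
  op_one := by
    ext1 u
    apply Lp.ext
    refine (coeFn_phaseMul ħ 1 _).trans ?_
    filter_upwards [Lp.coeFn_compMeasurePreserving u
      (measurePreserving_add_right volume (rootAbs ħ • (1 : Heis n).2.2))] with v hv
    change _ * (Lp.compMeasurePreserving _ _ u) v = u v
    rw [hv]
    simp [schPhase, heis_one_def]
  op_mul g h := by
    ext1 u
    apply Lp.ext
    refine (coeFn_phaseMul ħ (g * h) _).trans ?_
    refine .trans ?_ (coeFn_phaseMul ħ g _).symm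
    have hτ := measurePreserving_add_right (volume : Measure (V n)) (rootAbs ħ • g.2.2)
    filter_upwards [Lp.coeFn_compMeasurePreserving u
        (measurePreserving_add_right volume (rootAbs ħ • (g * h).2.2)),
      Lp.coeFn_compMeasurePreserving (phaseMul ħ h (Lp.compMeasurePreservingₗᵢ ℂ
        (fun v : V n => v + rootAbs ħ • h.2.2)
        (measurePreserving_add_right volume (rootAbs ħ • h.2.2)) u)) hτ,
      hτ.quasiMeasurePreserving.ae (coeFn_phaseMul ħ h (Lp.compMeasurePreservingₗᵢ ℂ
        (fun v : V n => v + rootAbs ħ • h.2.2)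
        (measurePreserving_add_right volume (rootAbs ħ • h.2.2)) u)),
      hτ.quasiMeasurePreserving.ae (Lp.coeFn_compMeasurePreserving u
        (measurePreserving_add_right volume (rootAbs ħ • h.2.2)))] with v h1 h2 h3 h4
    change _ * (Lp.compMeasurePreserving _ _ u) v =
      _ * (Lp.compMeasurePreserving _ _ (phaseMul ħ h _)) v
    rw [h1]
    refine .trans ?_ (congrArg (schPhase ħ g v * ·) h2.symm)
    simp only [Function.comp_apply] at h4 ⊢
    rw [h3]
    change _ = _ * (_ * (Lp.compMeasurePreserving _ _ u) _)
    rw [h4, ← mul_assoc]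
    congr 1
    · rw [schPhase, schPhase, schPhase, ← Complex.exp_add, ← mul_add, ← Complex.ofReal_add]
      congr 3
      simp only [heis_mul_def, inner_add_left, inner_add_right, inner_smul_right]
      have := signedRoot_mul_rootAbs ħ
      rw [real_inner_comm h.2.1 g.2.2]
      linear_combination (-(inner ℝ h.2.1 g.2.2)) * this
    · congr 1
      simp only [heis_mul_def, smul_add]
      abel
  norm_op g u := LinearIsometry.norm_map _ u
  continuous_op u := by
    have hc : Continuous fun p : Heis n × V n => p.2 + rootAbs ħ • p.1.2.2 := by fun_prop
    have hτ := Continuous.compMeasurePreservingLp (f := fun _ : Heis n => u)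
      (g := ContinuousMap.curry ⟨_, hc⟩) continuous_const (ContinuousMap.continuous _)
      (fun g => measurePreserving_add_right volume (rootAbs ħ • g.2.2)) (by norm_num)
    rw [continuous_iff_continuousAt]
    intro g₀
    rw [ContinuousAt, tendsto_iff_norm_sub_tendsto_zero]
    have h1 := tendsto_iff_norm_sub_tendsto_zero.1 (hτ.tendsto g₀)
    have h2 := tendsto_iff_norm_sub_tendsto_zero.1 ((continuous_phaseMul ħ
      (Lp.compMeasurePreserving _
        (measurePreserving_add_right volume (rootAbs ħ • g₀.2.2)) u)).tendsto g₀)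
    have h3 := h1.add h2
    rw [add_zero] at h3
    refine squeeze_zero (fun _ => norm_nonneg _) (fun g => ?_) h3
    refine (norm_sub_le_norm_sub_add_norm_sub _ (phaseMul ħ g (Lp.compMeasurePreserving _
        (measurePreserving_add_right volume (rootAbs ħ • g₀.2.2)) u)) _).trans ?_
    refine add_le_add_left (le_of_eq ?_) _
    refine Eq.trans ?_ ((phaseMul ħ g).norm_map _)
    rw [map_sub]
    rfl

/-- The image `π_ħ(k)` in the algebra of operators on `L²(ℝⁿ)` of the convolution with kernel `k`.
It is the superposition `(2π)^{-N/2} ∫ k(t,x,y) exp i(ħ t + sgn(ħ)|ħ|^{1/2} x·X + |ħ|^{1/2} y·D)`,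
i.e. the operator `k̂(ħ, sgn(ħ)|ħ|^{1/2} X, |ħ|^{1/2} D)` with Weyl symbol
`(v, ξ) ↦ k̂(ħ, sgn(ħ)|ħ|^{1/2} v, |ħ|^{1/2} ξ)`. -/
def quantumImage {n : ℕ} (ħ : Planck) (k : Kernel n) : L2 n →L[ℂ] L2 n :=
  (schrodinger n ħ).integrated k

/-- The Fourier transform
`k̂(τ, q, p) = (2π)^{-N/2} ∫ k(t, x, y) exp i(τ t + ⟨q, x⟩ + ⟨p, y⟩) dt dx dy`. -/
def fourier {n : ℕ} (k : Kernel n) (τ : ℝ) (q p : V n) : ℂ :=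
  normConst n * ∫ g : Heis n,
    k g * Complex.exp (Complex.I * ((τ * g.1 + inner ℝ q g.2.1 + inner ℝ p g.2.2 : ℝ) : ℂ))

/-- The phase space `ℝ²ⁿ`, the set of the one-dimensional representations
`π_{(q,p)}(t, x, y) = exp i(⟨q, x⟩ + ⟨p, y⟩)`. -/
abbrev Phase (n : ℕ) : Type := V n × V n

/-- The image `π_{(q,p)}(k) = k̂(0, q, p)` of the convolution with kernel `k` under the
one-dimensional representation `π_{(q,p)}`. -/
def classicalImage {n : ℕ} (k : Kernel n) (z : Phase n) : ℂ := fourier k 0 z.1 z.2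

/-- The Poisson bracket `{f, g} = ∑ⱼ (∂f/∂pⱼ ∂g/∂qⱼ - ∂f/∂qⱼ ∂g/∂pⱼ)` on the phase space. -/
def poisson {n : ℕ} (f g : Phase n → ℂ) (z : Phase n) : ℂ :=
  ∑ j : Fin n,
    (fderiv ℝ f z (0, EuclideanSpace.single j 1) * fderiv ℝ g z (EuclideanSpace.single j 1, 0)
      - fderiv ℝ f z (EuclideanSpace.single j 1, 0) * fderiv ℝ g z (0, EuclideanSpace.single j 1))

/-! ### The Jacobson topology and the limit `ħ → 0` -/

/-- The set `P ∪ M` of all irreducible representations of the convolution algebra. -/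
inductive Dual (n : ℕ) : Type
  | quantum (ħ : Planck)
  | classical (z : Phase n)

/-- The kernel `{k | π(k) = 0}` of a representation in `P ∪ M`. -/
def Dual.ker {n : ℕ} : Dual n → Set (Kernel n)
  | .quantum ħ => {k | quantumImage ħ k = 0}
  | .classical z => {k | classicalImage k z = 0}

/-- The Jacobson (hull-kernel) topology on `P ∪ M`: the open sets are generated by the sets
`{π | π(k) ≠ 0}`, `k ∈ L¹(ℍⁿ)`. -/
instance jacobson (n : ℕ) : TopologicalSpace (Dual n) :=
  TopologicalSpace.generateFrom (Set.range fun k : Kernel n => {π : Dual n | k ∉ π.ker})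

/-- The values at all representations: pairs `(π, T)` with `T` an operator on the space of `π`. -/
inductive Value (n : ℕ) : Type
  | quantum (ħ : Planck) (T : L2 n →L[ℂ] L2 n)
  | classical (z : Phase n) (c : ℂ)

/-- The graph `{(π, π(k))}` of the function on `P ∪ M` defined by a convolution kernel `k`. -/
def graph {n : ℕ} (k : Kernel n) : Set (Value n) :=
  {w | match w with
    | .quantum ħ T => T = quantumImage ħ k
    | .classical z c => c = classicalImage k z}

/-- The Jacobson topology on values: the coarsest topology in which all graphs are closed. Through
each map `π ↦ (π, π(k))` it induces the Jacobson topology on `P ∪ M`. -/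
instance jacobsonValue (n : ℕ) : TopologicalSpace (Value n) :=
  TopologicalSpace.generateFrom (Set.range fun k : Kernel n => (graph k)ᶜ)

/-- `lim_{ħ → 0} A_ħ = f`: for every point `z` of the phase space and every `c ∈ ℂ`, the value `c` at
`z` lies in the closure of `{A_ħ | ħ ∈ S ε}` for all `ε > 0` if and only if `c = f(z)`. Here `S ε` is
the set of the Planck constants over which `ħ` runs. -/
def IsJacobsonLimit {n : ℕ} (S : ℝ → Set Planck) (A : Planck → L2 n →L[ℂ] L2 n)
    (f : Phase n → ℂ) : Prop :=
  ∀ (z : Phase n) (c : ℂ),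
    (∀ ε > 0, Value.classical z c ∈ closure ((fun ħ => Value.quantum ħ (A ħ)) '' S ε)) ↔ c = f z

/-- The Planck constants in `(0, ε]`. -/
def posPlanck (ε : ℝ) : Set Planck := {ħ | 0 < ħ.1 ∧ ħ.1 ≤ ε}

/-- The Planck constants in `[-ε, 0)`. -/
def negPlanck (ε : ℝ) : Set Planck := {ħ | -ε ≤ ħ.1 ∧ ħ.1 < 0}

end PlainMechanics

end

noncomputable section

namespace PlainMechanics

/-! ### Integrating out the first variable of a skew product -/

section Fiber

variable {A : Type*} [MeasurableSpace A] {α : Measure A} [SFinite α] {n : ℕ}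
  {Φ : A → Heis n → Heis n}

/-! The products `h * g` and `g * h` differ only by the central element `symp g h`, on which `π_ħ`
acts by a scalar exponential. So the commutator of `π_ħ(K₁)` and `π_ħ(K₂)` is a double integral of
`k₁(g) k₂(h) (1 - exp(iħs)) π_ħ(gh)` with `s = symp g h`. Since `(i/ħ)(1 - exp(iħs)) = s ∫₀¹
exp(iħrs) dr` (`symp_mul_integral_exp`), dividing by `-iħ` spreads `s k₁(g) k₂(h)` along a central
segment. The kernel so obtained, `dividedKernel`, does not depend on `ħ`; it is in `L¹` because
`|s|` is at most the product of the two weights in the hypotheses (`integrable_mul_symp`).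
Characters are trivial on the centre, so its classical image is the Fourier integral of `s k₁(g)
k₂(h)`, which is the Poisson bracket (`classicalImage_dividedKernel`).

The limit thus concerns the images of a single kernel `b`. Uniqueness holds because the graph of `b`
is closed. Existence reduces to `eventually_quantumImage_ne_zero`: if `π_z(k) ≠ 0`, then `π_ħ(k) ≠
0` for all small `ħ`. There, conjugation by a group element depending on `ħ` multiplies `k` by the
character of `z`, while `π_ħ(g)` tends strongly to the identity; so the conjugated operators,
applied to a vector `u`, tend to `π_z(k) u`. -/

theorem measurePreserving_skew (hΦ : Measurable (Function.uncurry Φ))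
    (hmp : ∀ a, MeasurePreserving (Φ a) volume volume) :
    MeasurePreserving (fun p : A × Heis n => (p.1, Φ p.1 p.2)) (α.prod volume)
      (α.prod volume) :=
  (MeasurePreserving.id α).skew_product hΦ (.of_forall fun a => (hmp a).map_eq)

theorem integrable_comp_skew (hΦ : Measurable (Function.uncurry Φ))
    (hmp : ∀ a, MeasurePreserving (Φ a) volume volume) {F : A × Heis n → ℂ}
    (hF : Integrable F (α.prod volume)) :
    Integrable (fun p : A × Heis n => F (p.1, Φ p.1 p.2)) (α.prod volume) :=
  (measurePreserving_skew hΦ hmp).integrable_comp_of_integrable hF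

theorem integrable_smul_of_bounded {B : Type*} [MeasurableSpace B] {β : Measure B}
    {E : Type*} [NormedAddCommGroup E] [NormedSpace ℂ E]
    {F : B → ℂ} (hF : Integrable F β) {w : B → E} (hw : StronglyMeasurable w)
    (C : ℝ) (hC : ∀ g, ‖w g‖ ≤ C) :
    Integrable (fun p => F p • w p) β := by
  refine (hF.norm.mul_const C).mono' (hF.aestronglyMeasurable.smul hw.aestronglyMeasurable)
    (.of_forall fun p => ?_)
  rw [norm_smul]
  gcongr
  exact hC p

/-- Fubini, followed by the substitution `g ↦ Φ a g` in each fibre. It serves both the convolution,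
with parameter `h`, and the divided commutator, with parameter `(r, h)`. -/
theorem integral_fiberIntegral_smul (hΦ : Measurable (Function.uncurry Φ))
    (hmp : ∀ a, MeasurePreserving (Φ a) volume volume)
    {Ψ : A → Heis n → Heis n} (hΨ : Measurable (Function.uncurry Ψ))
    (hinv : ∀ a g, Ψ a (Φ a g) = g) {F : A × Heis n → ℂ} (hF : Integrable F (α.prod volume))
    {E : Type*} [NormedAddCommGroup E] [NormedSpace ℂ E] [CompleteSpace E]
    {w : Heis n → E} (hw : Continuous w) (C : ℝ) (hC : ∀ g, ‖w g‖ ≤ C) :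
    ∫ g, (∫ a, F (a, Φ a g) ∂α) • w g = ∫ p, F p • w (Ψ p.1 p.2) ∂(α.prod volume) := by
  have hw' : StronglyMeasurable w := hw.stronglyMeasurable
  have hint : Integrable (fun p : A × Heis n => F (p.1, Φ p.1 p.2) • w p.2) (α.prod volume) :=
    integrable_smul_of_bounded (integrable_comp_skew hΦ hmp hF)
      (hw'.comp_measurable measurable_snd) C fun _ => hC _
  simp_rw [← integral_smul_const]
  rw [← integral_prod_symm _ hint]
  have hs := measurePreserving_skew (α := α) hΦ hmp
  -- `Ψ` is only a left inverse on fibres, so the substitution is made through the image measure,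
  -- where measurability of the integrand has to be supplied.
  have hmeas : AEStronglyMeasurable (fun p : A × Heis n => F p • w (Ψ p.1 p.2))
      (Measure.map (fun p : A × Heis n => (p.1, Φ p.1 p.2)) (α.prod volume)) := by
    rw [hs.map_eq]
    exact hF.aestronglyMeasurable.smul (hw'.comp_measurable hΨ).aestronglyMeasurable
  have h := integral_map hs.aemeasurable hmeas
  rw [hs.map_eq] at h
  rw [h]
  simp only [hinv]

end Fiber

/-! ### Convolution kernels -/

theorem continuous_mul_heis {n : ℕ} {X : Type*} [TopologicalSpace X] {f g : X → Heis n}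
    (hf : Continuous f) (hg : Continuous g) : Continuous fun x => f x * g x :=
  (heis_continuous_mul n).comp (hf.prodMk hg)

theorem continuous_inv_heis {n : ℕ} {X : Type*} [TopologicalSpace X] {f : X → Heis n}
    (hf : Continuous f) : Continuous fun x => (f x)⁻¹ :=
  (heis_continuous_inv n).comp hf

section Conv

variable {n : ℕ}

theorem measurable_inv_mul :
    Measurable (Function.uncurry fun h g : Heis n => h⁻¹ * g) :=
  (continuous_mul_heis (continuous_inv_heis continuous_fst) continuous_snd).measurable

theorem integrable_tensor (k₁ k₂ : Kernel n) :
    Integrable (fun p : Heis n × Heis n => k₁ p.1 * k₂ p.2) (volume.prod volume) :=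
  (L1.integrable_coeFn k₁).mul_prod (L1.integrable_coeFn k₂)

theorem integrable_groupConv (k₁ k₂ : Kernel n) : Integrable (groupConv k₁ k₂) volume :=
  (integrable_comp_skew measurable_inv_mul (fun h => measurePreserving_mul_left h⁻¹)
    (integrable_tensor k₁ k₂)).integral_prod_right

/-- The convolution of two kernels as a kernel. -/
def convKernel (k₁ k₂ : Kernel n) : Kernel n := (integrable_groupConv k₁ k₂).toL1

theorem coeFn_convKernel (k₁ k₂ : Kernel n) :
    convKernel k₁ k₂ =ᵐ[volume] groupConv k₁ k₂ := Integrable.coeFn_toL1 _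

/-- The kernel of the commutator of the convolutions with kernels `k₁` and `k₂`. -/
def commutatorKernel (k₁ k₂ : Kernel n) : Kernel n :=
  (normConst n : ℂ) • (convKernel k₁ k₂ - convKernel k₂ k₁)

theorem coeFn_commutatorKernel (k₁ k₂ : Kernel n) :
    commutatorKernel k₁ k₂ =ᵐ[volume] commKernel k₁ k₂ := by
  filter_upwards [Lp.coeFn_smul (normConst n : ℂ) (convKernel k₁ k₂ - convKernel k₂ k₁),
    Lp.coeFn_sub (convKernel k₁ k₂) (convKernel k₂ k₁), coeFn_convKernel k₁ k₂,
    coeFn_convKernel k₂ k₁] with g h1 h2 h3 h4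
  rw [commutatorKernel, h1, Pi.smul_apply, h2, Pi.sub_apply, h3, h4, commKernel, smul_eq_mul]

end Conv

/-! ### Integrated forms: linearity and multiplicativity -/

section Rep

variable {n : ℕ} {H : Type*} [NormedAddCommGroup H] [InnerProductSpace ℂ H]

theorem UnitaryRep.integrated_sub (π : UnitaryRep (Heis n) H) (k l : Kernel n) :
    π.integrated (k - l) = π.integrated k - π.integrated l := by
  ext1 u
  rw [sub_apply]
  simp only [UnitaryRep.integrated_apply]
  rw [← smul_sub, ← integral_sub (π.integrable_smul k u) (π.integrable_smul l u)]
  congr 1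
  refine integral_congr_ae ?_
  filter_upwards [Lp.coeFn_sub k l] with g hg
  rw [hg, Pi.sub_apply, sub_smul]

theorem UnitaryRep.integrated_smul (π : UnitaryRep (Heis n) H) (c : ℂ) (k : Kernel n) :
    π.integrated (c • k) = c • π.integrated k := by
  ext1 u
  rw [smul_apply]
  simp only [UnitaryRep.integrated_apply]
  rw [smul_comm c, ← integral_smul c]
  congr 1
  refine integral_congr_ae ?_
  filter_upwards [Lp.coeFn_smul c k] with g hg
  rw [hg, Pi.smul_apply, smul_assoc]

theorem UnitaryRep.integrable_tensor_smul (π : UnitaryRep (Heis n) H) (k₁ k₂ : Kernel n) (u : H)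
    {φ : Heis n × Heis n → Heis n} (hφ : Continuous φ) :
    Integrable (fun p : Heis n × Heis n => (k₁ p.1 * k₂ p.2) • π.op (φ p) u)
      (volume.prod volume) :=
  integrable_smul_of_bounded (integrable_tensor k₁ k₂)
    ((π.continuous_op u).comp hφ).stronglyMeasurable ‖u‖ fun _ => (π.norm_op _ u).le

variable [CompleteSpace H]

theorem UnitaryRep.integrated_convKernel_apply (π : UnitaryRep (Heis n) H) (k₁ k₂ : Kernel n)
    (u : H) : π.integrated (convKernel k₁ k₂) u = (normConst n : ℂ) •
      ∫ p : Heis n × Heis n, (k₁ p.1 * k₂ p.2) • π.op (p.1 * p.2) u := by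
  rw [UnitaryRep.integrated_apply]
  congr 1
  rw [integral_congr_ae (g := fun g => groupConv k₁ k₂ g • π.op g u)
    ((coeFn_convKernel k₁ k₂).mono fun g hg => by simp only [hg])]
  exact integral_fiberIntegral_smul measurable_inv_mul
    (fun h => measurePreserving_mul_left h⁻¹) (heis_continuous_mul n).measurable
    (fun h g => mul_inv_cancel_left h g) (integrable_tensor k₁ k₂) (π.continuous_op u) ‖u‖
    fun g => (π.norm_op g u).le

/-- The product carries the normalizing constant twice, the integrated form of a convolution only
once; the remaining factor is the one in `commKernel`. -/
theorem UnitaryRep.integrated_mul_integrated (π : UnitaryRep (Heis n) H) (k₁ k₂ : Kernel n) :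
    π.integrated k₁ * π.integrated k₂ = (normConst n : ℂ) • π.integrated (convKernel k₁ k₂) := by
  ext1 u
  rw [smul_apply, π.integrated_convKernel_apply, mul_apply_eq_comp,
    π.integrated_apply k₂, map_smul, π.integrated_apply k₁]
  congr 2
  have hint := π.integrable_tensor_smul k₁ k₂ u (heis_continuous_mul n)
  refine Eq.trans ?_ (integral_prod _ hint).symm
  refine integral_congr_ae (.of_forall fun h => ?_)
  dsimp only
  rw [← ContinuousLinearMap.integral_comp_comm _ (π.integrable_smul k₂ u), ← integral_smul]
  refine integral_congr_ae (.of_forall fun g => ?_)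
  dsimp only
  rw [map_smul, smul_smul, π.op_mul, mul_apply_eq_comp]

/-- Stated for an arbitrary unitary representation, so that left and right convolutions are both
instances. -/
theorem UnitaryRep.integrated_commutatorKernel (π : UnitaryRep (Heis n) H) (k₁ k₂ : Kernel n) :
    π.integrated (commutatorKernel k₁ k₂) =
      π.integrated k₁ * π.integrated k₂ - π.integrated k₂ * π.integrated k₁ := by
  rw [commutatorKernel, π.integrated_smul, π.integrated_sub, smul_sub,
    π.integrated_mul_integrated, π.integrated_mul_integrated]

end Rep

/-! ### The classical images -/

section Classical

variable {n : ℕ}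

/-- The character `exp i(⟨q, x⟩ + ⟨p, y⟩)` of the Heisenberg group. -/
def character (z : Phase n) (g : Heis n) : ℂ :=
  Complex.exp (Complex.I * ((inner ℝ z.1 g.2.1 + inner ℝ z.2 g.2.2 : ℝ) : ℂ))

theorem norm_character (z : Phase n) (g : Heis n) : ‖character z g‖ = 1 := by
  rw [character, mul_comm, Complex.norm_exp_ofReal_mul_I]

theorem continuous_character :
    Continuous fun p : Phase n × Heis n => character p.1 p.2 := by
  unfold character
  fun_prop

theorem continuous_character_right (z : Phase n) : Continuous (character z) := by
  unfold character
  fun_prop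

theorem character_mul (z : Phase n) (g h : Heis n) :
    character z (g * h) = character z g * character z h := by
  rw [character, character, character, ← Complex.exp_add, ← mul_add, ← Complex.ofReal_add]
  congr 3
  simp only [heis_mul_def, inner_add_right]
  ring

theorem classicalImage_apply (k : Kernel n) (z : Phase n) :
    classicalImage k z = normConst n * ∫ g : Heis n, k g * character z g := by
  simp [classicalImage, fourier, character]

theorem integrable_mul_character (k : Kernel n) (z : Phase n) :
    Integrable (fun g => k g * character z g) volume := by
  have hk : Integrable (k : Heis n → ℂ) := L1.integrable_coeFn k
  refine hk.norm.mono' (hk.aestronglyMeasurable.mul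
    (continuous_character_right z).aestronglyMeasurable) (.of_forall fun g => ?_)
  simp [norm_character]

theorem classicalImage_sub (k l : Kernel n) (z : Phase n) :
    classicalImage (k - l) z = classicalImage k z - classicalImage l z := by
  simp only [classicalImage_apply]
  rw [← mul_sub, ← integral_sub (integrable_mul_character k z) (integrable_mul_character l z)]
  congr 1
  refine integral_congr_ae ?_
  filter_upwards [Lp.coeFn_sub k l] with g hg
  rw [hg, Pi.sub_apply, sub_mul]

/-- The real linear form `(q, p) ↦ ⟨x, q⟩ + ⟨y, p⟩`. -/
def pairing (g : Heis n) : Phase n →L[ℝ] ℝ :=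
  (innerSL ℝ g.2.1).coprod (innerSL ℝ g.2.2)

theorem pairing_apply (g : Heis n) (z : Phase n) :
    pairing g z = inner ℝ z.1 g.2.1 + inner ℝ z.2 g.2.2 := by
  simp [pairing, real_inner_comm]

theorem norm_pairing_le (g : Heis n) : ‖pairing g‖ ≤ ‖g.2.1‖ + ‖g.2.2‖ := by
  refine ContinuousLinearMap.opNorm_le_bound _ (by positivity) fun z => ?_
  rw [pairing_apply, add_mul]
  refine (norm_add_le _ _).trans (add_le_add ?_ ?_)
  · refine (norm_inner_le_norm _ _).trans ?_
    rw [mul_comm]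
    gcongr
    exact norm_fst_le z
  · refine (norm_inner_le_norm _ _).trans ?_
    rw [mul_comm]
    gcongr
    exact norm_snd_le z

theorem continuous_pairing : Continuous (pairing : Heis n → Phase n →L[ℝ] ℝ) := by
  have h : (pairing : Heis n → Phase n →L[ℝ] ℝ) = fun g =>
      (innerSL ℝ g.2.1).comp (ContinuousLinearMap.fst ℝ (V n) (V n)) +
        (innerSL ℝ g.2.2).comp (ContinuousLinearMap.snd ℝ (V n) (V n)) := by
    funext g
    ext z <;> simp [pairing]
  rw [h]
  fun_prop

/-- The derivative of `z ↦ character z g`. -/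
def characterDeriv (z : Phase n) (g : Heis n) : Phase n →L[ℝ] ℂ :=
  (character z g * Complex.I) • Complex.ofRealCLM.comp (pairing g)

theorem hasFDerivAt_character (z : Phase n) (g : Heis n) :
    HasFDerivAt (fun z => character z g) (characterDeriv z g) z := by
  have h : HasFDerivAt (fun z : Phase n => Complex.I * ((pairing g z : ℝ) : ℂ))
      (Complex.I • Complex.ofRealCLM.comp (pairing g)) z :=
    ((Complex.ofRealCLM.comp (pairing g)).hasFDerivAt (x := z)).const_mul Complex.I
  have h' := h.cexp
  simp only [pairing_apply, smul_smul] at h'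
  exact h'

theorem continuous_characterDeriv :
    Continuous fun p : Phase n × Heis n => characterDeriv p.1 p.2 := by
  unfold characterDeriv
  exact (continuous_character.mul continuous_const).smul
    (continuous_const.clm_comp (continuous_pairing.comp continuous_snd))

theorem norm_characterDeriv_le (z : Phase n) (g : Heis n) :
    ‖characterDeriv z g‖ ≤ ‖g.2.1‖ + ‖g.2.2‖ := by
  rw [characterDeriv, norm_smul, norm_mul, norm_character, Complex.norm_I, one_mul, one_mul]
  refine (ContinuousLinearMap.opNorm_comp_le _ _).trans ?_
  rw [Complex.ofRealCLM_norm, one_mul]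
  exact norm_pairing_le g

theorem norm_smul_characterDeriv_le (k : Kernel n) (z : Phase n) (g : Heis n) :
    ‖k g • characterDeriv z g‖ ≤ (‖g.2.1‖ + ‖g.2.2‖) * ‖k g‖ := by
  rw [norm_smul, mul_comm]
  gcongr
  exact norm_characterDeriv_le z g

theorem aestronglyMeasurable_smul_characterDeriv (k : Kernel n) (z : Phase n) :
    AEStronglyMeasurable (fun g => k g • characterDeriv z g) volume :=
  (Lp.aestronglyMeasurable k).smul
    (continuous_characterDeriv.comp (Continuous.prodMk_right z)).aestronglyMeasurable

theorem integrable_smul_characterDeriv {k : Kernel n}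
    (hk : Integrable (fun g : Heis n => (‖g.2.1‖ + ‖g.2.2‖) * ‖k g‖) volume) (z : Phase n) :
    Integrable (fun g => k g • characterDeriv z g) volume :=
  hk.mono' (aestronglyMeasurable_smul_characterDeriv k z)
    (.of_forall (norm_smul_characterDeriv_le k z))

/-- Differentiation under the integral sign: the first moment of `k` dominates the derivative of the
integrand uniformly in `z`. -/
theorem hasFDerivAt_classicalImage {k : Kernel n}
    (hk : Integrable (fun g : Heis n => (‖g.2.1‖ + ‖g.2.2‖) * ‖k g‖) volume) (z : Phase n) :
    HasFDerivAt (classicalImage k) ((normConst n : ℂ) • ∫ g, k g • characterDeriv z g) z := by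
  have h : HasFDerivAt (fun z => ∫ g : Heis n, k g * character z g)
      (∫ g, k g • characterDeriv z g) z := by
    refine hasFDerivAt_integral_of_dominated_of_fderiv_le (s := Set.univ) (𝕜 := ℝ)
      (F' := fun z g => k g • characterDeriv z g) Filter.univ_mem
      (.of_forall fun z => (integrable_mul_character k z).aestronglyMeasurable)
      (integrable_mul_character k z) (aestronglyMeasurable_smul_characterDeriv k z)
      (.of_forall fun g z _ => norm_smul_characterDeriv_le k z g) hk
      (.of_forall fun g z _ => (hasFDerivAt_character z g).const_mul (k g))
  have h2 := h.const_mul (normConst n : ℂ)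
  simp only [← classicalImage_apply] at h2
  exact h2

theorem contDiff_classicalImage {k : Kernel n}
    (hk : Integrable (fun g : Heis n => (‖g.2.1‖ + ‖g.2.2‖) * ‖k g‖) volume) :
    ContDiff ℝ 1 (classicalImage k) := by
  refine contDiff_one_iff_hasFDerivAt.2 ⟨_, ?_, hasFDerivAt_classicalImage hk⟩
  refine Continuous.const_smul (?_ : Continuous fun z => ∫ g, k g • characterDeriv z g)
    (normConst n : ℂ)
  exact continuous_of_dominated (aestronglyMeasurable_smul_characterDeriv k)
    (fun z => .of_forall (norm_smul_characterDeriv_le k z)) hk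
    (.of_forall fun g =>
      (continuous_characterDeriv.comp (Continuous.prodMk_left g)).const_smul (k g))

theorem fderiv_classicalImage_apply {k : Kernel n}
    (hk : Integrable (fun g : Heis n => (‖g.2.1‖ + ‖g.2.2‖) * ‖k g‖) volume) (z w : Phase n) :
    fderiv ℝ (classicalImage k) z w = normConst n * Complex.I *
      ∫ g, k g * character z g * ((inner ℝ w.1 g.2.1 + inner ℝ w.2 g.2.2 : ℝ) : ℂ) := by
  rw [(hasFDerivAt_classicalImage hk z).fderiv, smul_apply,
    ContinuousLinearMap.integral_apply (integrable_smul_characterDeriv hk z), smul_eq_mul, mul_assoc,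
    ← integral_const_mul Complex.I]
  congr 1
  refine integral_congr_ae (.of_forall fun g : Heis n => ?_)
  simp only [characterDeriv, smul_apply, ContinuousLinearMap.comp_apply,
    pairing_apply, Complex.ofRealCLM_apply, smul_eq_mul]
  ring

end Classical

/-! ### The kernel of the divided commutator -/

section Divided

variable {n : ℕ}

/-- The symplectic form `⟨x, y'⟩ - ⟨y, x'⟩`. -/
def symp (g h : Heis n) : ℝ := inner ℝ g.2.1 h.2.2 - inner ℝ g.2.2 h.2.1

theorem continuous_symp : Continuous fun p : Heis n × Heis n => symp p.1 p.2 := by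
  unfold symp
  fun_prop

theorem abs_symp_le (g h : Heis n) :
    |symp g h| ≤ (‖g.2.1‖ + ‖g.2.2‖) * (‖h.2.1‖ + ‖h.2.2‖) := by
  have h1 := abs_real_inner_le_norm g.2.1 h.2.2
  have h2 := abs_real_inner_le_norm g.2.2 h.2.1
  have h3 := abs_sub (inner ℝ g.2.1 h.2.2) (inner ℝ g.2.2 h.2.1)
  rw [symp]
  nlinarith [mul_nonneg (norm_nonneg g.2.1) (norm_nonneg h.2.1),
    mul_nonneg (norm_nonneg g.2.2) (norm_nonneg h.2.2)]

/-- The form is alternating, so translation by `g⁻¹` does not change its value. Hence `sweepInv`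
recovers from the image point the same central displacement that `sweep` used. -/
theorem symp_inv_mul (g h : Heis n) : symp g (g⁻¹ * h) = symp g h := by
  simp only [symp, heis_mul_def, heis_inv_def, inner_add_right, inner_neg_right,
    real_inner_comm g.2.1 g.2.2]
  ring

/-- Translation by `s` in the central direction. -/
def centralShift (s : ℝ) (g : Heis n) : Heis n := (g.1 + s, g.2)

theorem measurePreserving_centralShift_symp (r : ℝ) (h : Heis n) :
    MeasurePreserving (fun g : Heis n => centralShift (-(r * symp h g)) g) volume volume := by
  convert measurePreserving_shear (fun p : V n × V n =>
    -(r * (inner ℝ h.2.1 p.2 - inner ℝ h.2.2 p.1))) (by fun_prop) 0 using 2 with g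
  simp [centralShift, symp]

/-- The map `g ↦ h⁻¹ g z`, with `z` central depending on `r`, `h` and `g`. -/
def sweep (a : ℝ × Heis n) (g : Heis n) : Heis n :=
  a.2⁻¹ * centralShift (-(a.1 * symp a.2 g)) g

/-- The fiberwise inverse of `sweep`. -/
def sweepInv (a : ℝ × Heis n) (g : Heis n) : Heis n :=
  centralShift (a.1 * symp a.2 g) (a.2 * g)

theorem continuous_sweep : Continuous (Function.uncurry (sweep (n := n))) := by
  refine continuous_mul_heis (continuous_inv_heis (by fun_prop)) ?_
  unfold centralShift symp
  fun_prop

theorem continuous_sweepInv : Continuous (Function.uncurry (sweepInv (n := n))) := by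
  have h : Continuous fun p : (ℝ × Heis n) × Heis n => p.1.2 * p.2 :=
    continuous_mul_heis (by fun_prop) (by fun_prop)
  have h' : Continuous fun p : (ℝ × Heis n) × Heis n => p.1.1 * symp p.1.2 p.2 := by
    unfold symp
    fun_prop
  exact (h.fst.add h').prodMk h.snd

theorem measurePreserving_sweep (a : ℝ × Heis n) :
    MeasurePreserving (sweep a) volume volume :=
  (measurePreserving_mul_left a.2⁻¹).comp (measurePreserving_centralShift_symp a.1 a.2)

theorem sweepInv_sweep (a : ℝ × Heis n) (g : Heis n) : sweepInv a (sweep a g) = g := by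
  rw [sweepInv, sweep, symp_inv_mul, mul_inv_cancel_left]
  simp [centralShift, symp]

/-- The half-cocycles of the two products are opposite, so their difference is the full symplectic
form. -/
theorem mul_comm_heis (g h : Heis n) : h * g = centralShift (symp g h) (g * h) := by
  simp only [heis_mul_def, centralShift, symp, Prod.mk.injEq, add_comm, and_true,
    real_inner_comm g.2.1, real_inner_comm g.2.2]
  ring

/-- The uniform measure on `[0, 1]`. -/
abbrev unitMeasure : Measure ℝ := volume.restrict (Set.Ioc 0 1)

/-- By `abs_symp_le` the form is dominated by a product of weights, one for each kernel; this is
where both moment hypotheses are needed together. -/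
theorem integrable_mul_symp {k₁ k₂ : Kernel n}
    (hk₁ : Integrable (fun g : Heis n => (‖g.2.1‖ + ‖g.2.2‖) * ‖k₁ g‖) volume)
    (hk₂ : Integrable (fun g : Heis n => (‖g.2.1‖ + ‖g.2.2‖) * ‖k₂ g‖) volume) :
    Integrable (fun p : Heis n × Heis n => k₁ p.1 * k₂ p.2 * (symp p.1 p.2 : ℂ))
      (volume.prod volume) := by
  refine (hk₁.mul_prod hk₂).mono' ((integrable_tensor k₁ k₂).aestronglyMeasurable.mul
    (Complex.continuous_ofReal.comp continuous_symp).aestronglyMeasurable)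
    (.of_forall fun p => ?_)
  rw [norm_mul, norm_mul, Complex.norm_real, Real.norm_eq_abs]
  calc ‖k₁ p.1‖ * ‖k₂ p.2‖ * |symp p.1 p.2|
      ≤ ‖k₁ p.1‖ * ‖k₂ p.2‖ *
        ((‖p.1.2.1‖ + ‖p.1.2.2‖) * (‖p.2.2.1‖ + ‖p.2.2.2‖)) := by
        gcongr
        exact abs_symp_le _ _
    _ = _ := by ring

/-- The integrand of the kernel of the divided commutator. -/
def sweepIntegrand (k₁ k₂ : Kernel n) (p : (ℝ × Heis n) × Heis n) : ℂ :=
  k₁ p.1.2 * k₂ p.2 * (symp p.1.2 p.2 : ℂ)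

theorem integrable_sweepIntegrand {k₁ k₂ : Kernel n}
    (hk₁ : Integrable (fun g : Heis n => (‖g.2.1‖ + ‖g.2.2‖) * ‖k₁ g‖) volume)
    (hk₂ : Integrable (fun g : Heis n => (‖g.2.1‖ + ‖g.2.2‖) * ‖k₂ g‖) volume) :
    Integrable (sweepIntegrand k₁ k₂) ((unitMeasure.prod volume).prod volume) :=
  (measurePreserving_prodAssoc unitMeasure (volume : Measure (Heis n))
    (volume : Measure (Heis n))).integrable_comp_of_integrable
    ((integrable_mul_symp hk₁ hk₂).comp_snd unitMeasure)

theorem integrable_sweepIntegral {k₁ k₂ : Kernel n}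
    (hk₁ : Integrable (fun g : Heis n => (‖g.2.1‖ + ‖g.2.2‖) * ‖k₁ g‖) volume)
    (hk₂ : Integrable (fun g : Heis n => (‖g.2.1‖ + ‖g.2.2‖) * ‖k₂ g‖) volume) :
    Integrable (fun g => ∫ a, sweepIntegrand k₁ k₂ (a, sweep a g) ∂(unitMeasure.prod volume))
      volume :=
  (integrable_comp_skew continuous_sweep.measurable measurePreserving_sweep
    (integrable_sweepIntegrand hk₁ hk₂)).integral_prod_right

/-- The kernel `(2π)^{-N/2} ∫ k₁(h) ∫_{-s}^{s} k₂(t - t' + r, x - x', y - y') dr dh`, where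
`s = (⟨x', y⟩ - ⟨y', x⟩) / 2`, of the convolution obtained by dividing the commutator by `-iħ`. -/
def dividedKernel {k₁ k₂ : Kernel n}
    (hk₁ : Integrable (fun g : Heis n => (‖g.2.1‖ + ‖g.2.2‖) * ‖k₁ g‖) volume)
    (hk₂ : Integrable (fun g : Heis n => (‖g.2.1‖ + ‖g.2.2‖) * ‖k₂ g‖) volume) : Kernel n :=
  (normConst n : ℂ) • (integrable_sweepIntegral hk₁ hk₂).toL1

variable {k₁ k₂ : Kernel n}

/-- The values of `w` lie in any Banach space, so one formula yields both images: `w g = π.op g u`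
for the quantum ones and `w = character z` for the classical ones. -/
theorem integral_dividedKernel_smul
    (hk₁ : Integrable (fun g : Heis n => (‖g.2.1‖ + ‖g.2.2‖) * ‖k₁ g‖) volume)
    (hk₂ : Integrable (fun g : Heis n => (‖g.2.1‖ + ‖g.2.2‖) * ‖k₂ g‖) volume)
    {E : Type*} [NormedAddCommGroup E] [NormedSpace ℂ E] [CompleteSpace E]
    {w : Heis n → E} (hw : Continuous w) (C : ℝ) (hC : ∀ g, ‖w g‖ ≤ C) :
    ∫ g, dividedKernel hk₁ hk₂ g • w g = (normConst n : ℂ) •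
      ∫ p : Heis n × Heis n, (k₁ p.1 * k₂ p.2) • (symp p.1 p.2 : ℂ) •
        ∫ r in (0 : ℝ)..1, w (centralShift (r * symp p.1 p.2) (p.1 * p.2)) := by
  have h1 : ∫ g, dividedKernel hk₁ hk₂ g • w g = (normConst n : ℂ) •
      ∫ g, (∫ a, sweepIntegrand k₁ k₂ (a, sweep a g) ∂(unitMeasure.prod volume)) • w g := by
    rw [← integral_smul]
    refine integral_congr_ae ?_
    filter_upwards [Lp.coeFn_smul (normConst n : ℂ) (integrable_sweepIntegral hk₁ hk₂).toL1,
      Integrable.coeFn_toL1 (integrable_sweepIntegral hk₁ hk₂)] with g h h'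
    rw [dividedKernel, h, Pi.smul_apply, h', smul_assoc]
  rw [h1, integral_fiberIntegral_smul continuous_sweep.measurable measurePreserving_sweep
    continuous_sweepInv.measurable sweepInv_sweep (integrable_sweepIntegrand hk₁ hk₂) hw C hC]
  congr 1
  have hassoc := measurePreserving_prodAssoc unitMeasure (volume : Measure (Heis n))
    (volume : Measure (Heis n))
  -- Regrouping `((r, h), g)` as `(r, (h, g))` allows Fubini to put the integral over `r` innermost.
  let G : ℝ × Heis n × Heis n → E := fun q => (k₁ q.2.1 * k₂ q.2.2 * (symp q.2.1 q.2.2 : ℂ)) •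
    w (centralShift (q.1 * symp q.2.1 q.2.2) (q.2.1 * q.2.2))
  have hG : Integrable G (unitMeasure.prod (volume.prod volume)) := by
    have hc : Continuous fun q : ℝ × Heis n × Heis n =>
        centralShift (q.1 * symp q.2.1 q.2.2) (q.2.1 * q.2.2) :=
      continuous_sweepInv.comp ((continuous_fst.prodMk continuous_snd.fst).prodMk
        continuous_snd.snd)
    exact integrable_smul_of_bounded ((integrable_mul_symp hk₁ hk₂).comp_snd unitMeasure)
      (hw.comp hc).stronglyMeasurable C fun _ => hC _
  refine (hassoc.integral_comp' G).trans ?_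
  rw [integral_prod_symm G hG]
  refine integral_congr_ae (.of_forall fun p => ?_)
  simp only [G, intervalIntegral.integral_of_le zero_le_one, mul_smul, integral_smul]

/-! ### Dividing the commutator by the Planck constant -/

theorem op_centralShift (ħ : Planck) (s : ℝ) (g : Heis n) (u : L2 n) :
    (schrodinger n ħ).op (centralShift s g) u =
      Complex.exp (Complex.I * ħ.1 * s) • (schrodinger n ħ).op g u := by
  apply Lp.ext
  refine (coeFn_phaseMul ħ (centralShift s g) _).trans ?_
  refine .trans ?_ (Lp.coeFn_smul _ _).symm
  filter_upwards [coeFn_phaseMul ħ g (Lp.compMeasurePreservingₗᵢ ℂ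
    (fun v : V n => v + rootAbs ħ • g.2.2)
    (measurePreserving_add_right volume (rootAbs ħ • g.2.2)) u)] with v hv
  refine Eq.trans ?_ (congrArg (Complex.exp (Complex.I * ħ.1 * s) • ·) hv.symm)
  rw [smul_eq_mul, ← mul_assoc]
  congr 1
  rw [schPhase, schPhase, ← Complex.exp_add]
  congr 1
  simp only [centralShift]
  push_cast
  ring

/-- The primitive of the exponential has denominator `iħs`, whose factor `s` cancels; `s = 0` is
separate. No power of `ħ` is left on the integral side. -/
theorem symp_mul_integral_exp (ħ : Planck) (s : ℝ) :
    (s : ℂ) * ∫ r in (0 : ℝ)..1, Complex.exp (Complex.I * ħ.1 * (r * s : ℝ)) =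
      Complex.I / (ħ.1 : ℂ) * (1 - Complex.exp (Complex.I * ħ.1 * s)) := by
  have hħ : (ħ.1 : ℂ) ≠ 0 := Complex.ofReal_ne_zero.2 ħ.2
  rcases eq_or_ne s 0 with rfl | hs
  · simp
  have hs' : (s : ℂ) ≠ 0 := Complex.ofReal_ne_zero.2 hs
  have hc : Complex.I * ħ.1 * s ≠ 0 := mul_ne_zero (mul_ne_zero Complex.I_ne_zero hħ) hs'
  have h := integral_exp_mul_complex (a := 0) (b := 1) hc
  have h' : ∀ r : ℝ, Complex.I * ħ.1 * (r * s : ℝ) = Complex.I * ħ.1 * s * r := fun r => by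
    push_cast
    ring
  simp only [h', h, Complex.ofReal_one, Complex.ofReal_zero, mul_one, mul_zero, Complex.exp_zero]
  field_simp
  rw [Complex.I_sq]
  ring

theorem UnitaryRep.integrated_commutatorKernel_apply {H : Type*} [NormedAddCommGroup H]
    [InnerProductSpace ℂ H] [CompleteSpace H] (π : UnitaryRep (Heis n) H) (k₁ k₂ : Kernel n)
    (u : H) : π.integrated (commutatorKernel k₁ k₂) u = (normConst n : ℂ) • (normConst n : ℂ) •
      ∫ p : Heis n × Heis n,
        (k₁ p.1 * k₂ p.2) • (π.op (p.1 * p.2) u - π.op (p.2 * p.1) u) := by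
  -- Exchanging the two variables in the second product gives both terms the common factor `k₁ p.1 *
  -- k₂ p.2`, so that only the order of the group elements differs.
  have hswap : ∫ p : Heis n × Heis n, (k₂ p.1 * k₁ p.2) • π.op (p.1 * p.2) u =
      ∫ p : Heis n × Heis n, (k₁ p.1 * k₂ p.2) • π.op (p.2 * p.1) u := by
    refine (integral_prod_swap
      (fun p : Heis n × Heis n => (k₂ p.1 * k₁ p.2) • π.op (p.1 * p.2) u)).symm.trans ?_
    refine integral_congr_ae (.of_forall fun p => ?_)
    simp [mul_comm]
  have h₁ : Integrable (fun p : Heis n × Heis n => (k₁ p.1 * k₂ p.2) • π.op (p.1 * p.2) u) :=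
    π.integrable_tensor_smul k₁ k₂ u (heis_continuous_mul n)
  have h₂ : Integrable (fun p : Heis n × Heis n => (k₁ p.1 * k₂ p.2) • π.op (p.2 * p.1) u) :=
    π.integrable_tensor_smul k₁ k₂ u (continuous_mul_heis continuous_snd continuous_fst)
  rw [commutatorKernel, π.integrated_smul, smul_apply, π.integrated_sub, sub_apply,
    π.integrated_convKernel_apply, π.integrated_convKernel_apply, hswap, ← smul_sub,
    ← integral_sub h₁ h₂]
  simp only [smul_sub]

/-- Only the scalar action of the centre matters: it turns the difference between `π(gh)` and
`π(hg)` into `1 - exp(iħs)` times `π(gh)`. -/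
theorem UnitaryRep.integrated_dividedKernel {H : Type*} [NormedAddCommGroup H]
    [InnerProductSpace ℂ H] [CompleteSpace H] (π : UnitaryRep (Heis n) H) (ħ : Planck)
    (hπ : ∀ s g u, π.op (centralShift s g) u = Complex.exp (Complex.I * ħ.1 * s) • π.op g u)
    (hk₁ : Integrable (fun g : Heis n => (‖g.2.1‖ + ‖g.2.2‖) * ‖k₁ g‖) volume)
    (hk₂ : Integrable (fun g : Heis n => (‖g.2.1‖ + ‖g.2.2‖) * ‖k₂ g‖) volume) :
    π.integrated (dividedKernel hk₁ hk₂) =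
      (Complex.I / (ħ.1 : ℂ)) • π.integrated (commutatorKernel k₁ k₂) := by
  ext1 u
  rw [smul_apply, π.integrated_commutatorKernel_apply, UnitaryRep.integrated_apply,
    integral_dividedKernel_smul hk₁ hk₂ (π.continuous_op u) ‖u‖ fun g => (π.norm_op g u).le,
    smul_comm (Complex.I / (ħ.1 : ℂ)), smul_comm (Complex.I / (ħ.1 : ℂ)),
    ← integral_smul (Complex.I / (ħ.1 : ℂ))]
  congr 2
  refine integral_congr_ae (.of_forall fun p => ?_)
  dsimp only
  rw [mul_comm_heis p.1 p.2, smul_comm (Complex.I / (ħ.1 : ℂ))]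
  congr 1
  simp only [hπ]
  rw [intervalIntegral.integral_smul_const, smul_smul, symp_mul_integral_exp, mul_smul, sub_smul,
    one_smul]

theorem quantumImage_dividedKernel
    (hk₁ : Integrable (fun g : Heis n => (‖g.2.1‖ + ‖g.2.2‖) * ‖k₁ g‖) volume)
    (hk₂ : Integrable (fun g : Heis n => (‖g.2.1‖ + ‖g.2.2‖) * ‖k₂ g‖) volume) (ħ : Planck) :
    quantumImage ħ (dividedKernel hk₁ hk₂) =
      (Complex.I / (ħ.1 : ℂ)) • quantumImage ħ (commutatorKernel k₁ k₂) :=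
  (schrodinger n ħ).integrated_dividedKernel ħ (op_centralShift ħ) hk₁ hk₂

/-! ### The Poisson bracket as a classical image -/

theorem inner_eq_sum_mul (x y : V n) : inner ℝ x y = ∑ j, x j * y j := by
  simp [PiLp.inner_apply, mul_comm]

theorem integrable_mul_character_coord {k : Kernel n}
    (hk : Integrable (fun g : Heis n => (‖g.2.1‖ + ‖g.2.2‖) * ‖k g‖) volume) (z : Phase n)
    {ℓ : Heis n → ℝ} (hℓ : Continuous ℓ) (hle : ∀ g, |ℓ g| ≤ ‖g.2.1‖ + ‖g.2.2‖) :
    Integrable (fun g => k g * character z g * (ℓ g : ℂ)) volume := by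
  refine hk.mono' ((integrable_mul_character k z).aestronglyMeasurable.mul
    (Complex.continuous_ofReal.comp hℓ).aestronglyMeasurable) (.of_forall fun g => ?_)
  rw [norm_mul, norm_mul, norm_character, mul_one, Complex.norm_real, mul_comm, Real.norm_eq_abs]
  gcongr
  exact hle g

/-- The average over `r` disappears because characters ignore the centre. In coordinates the form is
a sum of products of a function of one variable and a function of the other, so the double integral
splits into first moments, which are derivatives of the classical images. -/
theorem classicalImage_dividedKernel
    (hk₁ : Integrable (fun g : Heis n => (‖g.2.1‖ + ‖g.2.2‖) * ‖k₁ g‖) volume)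
    (hk₂ : Integrable (fun g : Heis n => (‖g.2.1‖ + ‖g.2.2‖) * ‖k₂ g‖) volume) :
    classicalImage (dividedKernel hk₁ hk₂) =
      poisson (classicalImage k₁) (classicalImage k₂) := by
  funext z
  have hcentral : ∀ (s : ℝ) (g : Heis n), character z (centralShift s g) = character z g :=
    fun s g => rfl
  have hx : ∀ {k : Kernel n},
      Integrable (fun g : Heis n => (‖g.2.1‖ + ‖g.2.2‖) * ‖k g‖) volume → ∀ j,
      Integrable (fun g => k g * character z g * ((g.2.1 j : ℝ) : ℂ)) volume := fun hk j =>
    integrable_mul_character_coord hk z (by fun_prop) fun g =>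
      (PiLp.norm_apply_le g.2.1 j).trans (le_add_of_nonneg_right (norm_nonneg _))
  have hy : ∀ {k : Kernel n},
      Integrable (fun g : Heis n => (‖g.2.1‖ + ‖g.2.2‖) * ‖k g‖) volume → ∀ j,
      Integrable (fun g => k g * character z g * ((g.2.2 j : ℝ) : ℂ)) volume := fun hk j =>
    integrable_mul_character_coord hk z (by fun_prop) fun g =>
      (PiLp.norm_apply_le g.2.2 j).trans (le_add_of_nonneg_left (norm_nonneg _))
  have h1 : ∫ g, dividedKernel hk₁ hk₂ g * character z g = normConst n *
      ∫ p : Heis n × Heis n, ∑ j,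
        ((k₁ p.1 * character z p.1 * ((p.1.2.1 j : ℝ) : ℂ)) *
            (k₂ p.2 * character z p.2 * ((p.2.2.2 j : ℝ) : ℂ)) -
          (k₁ p.1 * character z p.1 * ((p.1.2.2 j : ℝ) : ℂ)) *
            (k₂ p.2 * character z p.2 * ((p.2.2.1 j : ℝ) : ℂ)))
        ∂((volume : Measure (Heis n)).prod (volume : Measure (Heis n))) := by
    have h := integral_dividedKernel_smul hk₁ hk₂ (continuous_character_right z) 1
      fun g => (norm_character z g).le
    simp only [smul_eq_mul, hcentral, intervalIntegral.integral_const, sub_zero, one_smul] at h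
    rw [h]
    congr 1
    refine integral_congr_ae (.of_forall fun p => ?_)
    dsimp only
    rw [character_mul, symp, inner_eq_sum_mul, inner_eq_sum_mul, ← Finset.sum_sub_distrib,
      Complex.ofReal_sum, Finset.sum_mul, Finset.mul_sum]
    refine Finset.sum_congr rfl fun j _ => ?_
    push_cast
    ring
  rw [classicalImage_apply, h1, poisson, integral_finsetSum, Finset.mul_sum, Finset.mul_sum]
  · refine Finset.sum_congr rfl fun j _ => ?_
    rw [integral_sub ((hx hk₁ j).mul_prod (hy hk₂ j)) ((hy hk₁ j).mul_prod (hx hk₂ j)),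
      integral_prod_mul (fun g => k₁ g * character z g * ((g.2.1 j : ℝ) : ℂ))
        (fun g => k₂ g * character z g * ((g.2.2 j : ℝ) : ℂ)),
      integral_prod_mul (fun g => k₁ g * character z g * ((g.2.2 j : ℝ) : ℂ))
        (fun g => k₂ g * character z g * ((g.2.1 j : ℝ) : ℂ))]
    simp only [fderiv_classicalImage_apply hk₁, fderiv_classicalImage_apply hk₂, inner_zero_left,
      zero_add, add_zero, EuclideanSpace.inner_single_left, map_one, one_mul]
    -- Each derivative contributes a factor `i`; their product `-1` reverses the difference in the
    -- Poisson bracket to the order of terms in `symp`.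
    ring_nf
    rw [Complex.I_sq]
    ring
  · exact fun j _ => ((hx hk₁ j).mul_prod (hy hk₂ j)).sub ((hy hk₁ j).mul_prod (hx hk₂ j))

end Divided

/-! ### The representations `π_ħ` for small `ħ` -/

section Limit

variable {n : ℕ}

/-- The Planck constants `1` and `-1`, with the sign of `ħ`. -/
def unitPlanck (ħ : Planck) : Planck := ⟨SignType.sign ħ.1, by
  rcases lt_or_gt_of_ne ħ.2 with h | h <;> simp [h]⟩

/-- The dilation `(t, x, y) ↦ (λ² t, λ x, λ y)` of the Heisenberg group. -/
def dilation (l : ℝ) (g : Heis n) : Heis n := (l ^ 2 * g.1, l • g.2.1, l • g.2.2)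

theorem rootAbs_unitPlanck (ħ : Planck) : rootAbs (unitPlanck ħ) = 1 := by
  rcases lt_or_gt_of_ne ħ.2 with h | h <;> simp [rootAbs, unitPlanck, h]

theorem signedRoot_unitPlanck (ħ : Planck) :
    signedRoot (unitPlanck ħ) = SignType.sign ħ.1 := by
  rcases lt_or_gt_of_ne ħ.2 with h | h <;> simp [signedRoot, unitPlanck, h]

theorem schPhase_dilation (ħ : Planck) (g : Heis n) (v : V n) :
    schPhase (unitPlanck ħ) (dilation (rootAbs ħ) g) v = schPhase ħ g v := by
  have h : rootAbs ħ ^ 2 = |ħ.1| := Real.sq_sqrt (abs_nonneg _)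
  have h' : (SignType.sign ħ.1 : ℝ) * rootAbs ħ ^ 2 = ħ.1 := by rw [h, sign_mul_abs]
  rw [schPhase, schPhase, signedRoot_unitPlanck]
  congr 3
  simp only [dilation, unitPlanck, inner_smul_left, inner_smul_right, signedRoot,
    conj_trivial]
  change _ = ħ.1 * g.1 + SignType.sign ħ.1 * rootAbs ħ * _ + _
  linear_combination (g.1 + inner ℝ g.2.1 g.2.2 / 2) * h'

/-- Moves the dependence on `ħ` into the group element, with one of two fixed representations. As `ħ
→ 0` the dilated element tends to the identity, and strong continuity applies. -/
theorem op_unitPlanck_dilation (ħ : Planck) (g : Heis n) (u : L2 n) :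
    (schrodinger n (unitPlanck ħ)).op (dilation (rootAbs ħ) g) u =
      (schrodinger n ħ).op g u := by
  apply Lp.ext
  refine (coeFn_phaseMul (unitPlanck ħ) _ _).trans ?_
  refine .trans ?_ (coeFn_phaseMul ħ g _).symm
  have h : rootAbs (unitPlanck ħ) • (dilation (rootAbs ħ) g).2.2 = rootAbs ħ • g.2.2 := by
    rw [rootAbs_unitPlanck, one_smul, dilation]
  simp only [schPhase_dilation, h]
  rfl

/-- The filter of Planck constants tending to zero. -/
def planckZero : Filter Planck := comap Subtype.val (𝓝 0)

/-- Dominated convergence along `planckZero` requires this. -/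
instance : planckZero.IsCountablyGenerated := by
  unfold planckZero
  infer_instance

theorem tendsto_op_planckZero (g : Heis n) (u : L2 n) :
    Tendsto (fun ħ => (schrodinger n ħ).op g u) planckZero (𝓝 u) := by
  have hroot : Tendsto rootAbs planckZero (𝓝 0) := by
    have h : Continuous fun s : ℝ => Real.sqrt |s| := by fun_prop
    have h' := (h.tendsto 0).comp (tendsto_comap (f := (Subtype.val : Planck → ℝ)))
    simp only [abs_zero, Real.sqrt_zero] at h'
    exact h'
  have hunit : ∀ ε : Planck, Tendsto (fun ħ => (schrodinger n ε).op (dilation (rootAbs ħ) g) u)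
      planckZero (𝓝 u) := fun ε => by
    have hd : Continuous fun l : ℝ => dilation l g := by
      unfold dilation
      fun_prop
    have h0 : dilation 0 g = 1 := by simp [dilation, heis_one_def]
    have h := ((((schrodinger n ε).continuous_op u).comp hd).tendsto 0).comp hroot
    simpa [Function.comp_def, h0, (schrodinger n ε).op_one] using h
  have hsign : ∀ ħ : Planck, unitPlanck ħ = ⟨1, one_ne_zero⟩ ∨
      unitPlanck ħ = ⟨-1, neg_ne_zero.2 one_ne_zero⟩ := fun ħ => by
    rcases lt_or_gt_of_ne ħ.2 with h | h
    · right
      simp [unitPlanck, h]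
    · left
      simp [unitPlanck, h]
  -- The sign of `ħ` is not constant along the filter, so the limits for both signs are used
  -- simultaneously.
  intro s hs
  have h₁ := hunit ⟨1, one_ne_zero⟩ hs
  have h₂ := hunit ⟨-1, neg_ne_zero.2 one_ne_zero⟩ hs
  rw [mem_map] at h₁ h₂ ⊢
  filter_upwards [h₁, h₂] with ħ h1 h2
  rw [Set.mem_preimage, ← op_unitPlanck_dilation]
  rcases hsign ħ with h | h <;> rw [h] <;> assumption

/-! ### Twisting by a character and non-vanishing near a classical point -/

/-- The group element whose conjugation tensors `π_ħ` with the character of `z`. -/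
def phaseShift (ħ : Planck) (z : Phase n) : Heis n := (0, ħ.1⁻¹ • z.2, -(ħ.1⁻¹ • z.1))

theorem mul_phaseShift (ħ : Planck) (z : Phase n) (g : Heis n) :
    g * phaseShift ħ z =
      phaseShift ħ z * centralShift (ħ.1⁻¹ * (inner ℝ z.1 g.2.1 + inner ℝ z.2 g.2.2)) g := by
  simp only [phaseShift, centralShift, heis_mul_def, Prod.mk.injEq, add_comm, and_true,
    inner_smul_left, inner_smul_right, inner_neg_left, inner_neg_right, conj_trivial,
    real_inner_comm z.1 g.2.1, real_inner_comm z.2 g.2.2]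
  ring

/-- Moving `g` past the shift leaves a central element of size `ħ⁻¹(⟨q, x⟩ + ⟨p, y⟩)`; the central
character of `π_ħ` cancels `ħ⁻¹` and gives exactly `character z g`. -/
theorem op_mul_phaseShift (ħ : Planck) (z : Phase n) (g : Heis n) (u : L2 n) :
    (schrodinger n ħ).op g ((schrodinger n ħ).op (phaseShift ħ z) u) =
      (schrodinger n ħ).op (phaseShift ħ z) (character z g • (schrodinger n ħ).op g u) := by
  have hħ : (ħ.1 : ℂ) ≠ 0 := Complex.ofReal_ne_zero.2 ħ.2
  rw [← mul_apply_eq_comp, ← UnitaryRep.op_mul, mul_phaseShift, UnitaryRep.op_mul,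
    mul_apply_eq_comp, op_centralShift]
  congr 2
  rw [character]
  congr 1
  push_cast
  field_simp

theorem quantumImage_phaseShift (ħ : Planck) (z : Phase n) (k : Kernel n) (u : L2 n) :
    quantumImage ħ k ((schrodinger n ħ).op (phaseShift ħ z) u) =
      (schrodinger n ħ).op (phaseShift ħ z) ((normConst n : ℂ) •
        ∫ g, (k g * character z g) • (schrodinger n ħ).op g u) := by
  have hint : Integrable (fun g => (k g * character z g) • (schrodinger n ħ).op g u) volume :=
    integrable_smul_of_bounded (integrable_mul_character k z)
      ((schrodinger n ħ).continuous_op u).stronglyMeasurable ‖u‖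
      fun g => ((schrodinger n ħ).norm_op g u).le
  rw [quantumImage, UnitaryRep.integrated_apply, map_smul,
    ← ContinuousLinearMap.integral_comp_comm _ hint]
  simp only [op_mul_phaseShift, map_smul, mul_smul]
  rfl

theorem exists_ne_zero_L2 (n : ℕ) : ∃ u : L2 n, u ≠ 0 := by
  have hfin : volume (Metric.ball (0 : V n) 1) ≠ ⊤ := measure_ball_lt_top.ne
  refine ⟨indicatorConstLp 2 measurableSet_ball hfin (1 : ℂ), ?_⟩
  rw [← norm_ne_zero_iff, norm_indicatorConstLp (by norm_num) (by norm_num), norm_one, one_mul]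
  refine (Real.rpow_pos_of_pos ?_ _).ne'
  exact ENNReal.toReal_pos (Metric.measure_ball_pos volume 0 one_pos).ne' hfin

/-- On the shifted vectors, `π_ħ(k)` acts up to an isometry as the integral of `k · character z`
against `π_ħ`. By dominated convergence this tends on a fixed `u ≠ 0` to a nonzero multiple of `u`.
-/
theorem eventually_quantumImage_ne_zero {k : Kernel n} {z : Phase n}
    (hz : classicalImage k z ≠ 0) : ∀ᶠ ħ in planckZero, quantumImage ħ k ≠ 0 := by
  obtain ⟨u, hu⟩ := exists_ne_zero_L2 n
  have hlim : Tendsto (fun ħ => (normConst n : ℂ) •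
      ∫ g, (k g * character z g) • (schrodinger n ħ).op g u) planckZero
      (𝓝 (classicalImage k z • u)) := by
    rw [classicalImage_apply, mul_smul, ← integral_smul_const]
    refine Tendsto.const_smul ?_ _
    refine tendsto_integral_filter_of_dominated_convergence (fun g => ‖k g‖ * ‖u‖)
      (.of_forall fun ħ => (integrable_mul_character k z).aestronglyMeasurable.smul
        ((schrodinger n ħ).continuous_op u).aestronglyMeasurable)
      (.of_forall fun ħ => .of_forall fun g => ?_)
      ((L1.integrable_coeFn k).norm.mul_const ‖u‖)
      (.of_forall fun g => (tendsto_op_planckZero g u).const_smul _)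
    rw [norm_smul, norm_mul, norm_character, mul_one, UnitaryRep.norm_op]
  filter_upwards [hlim.eventually_ne (smul_ne_zero hz hu)] with ħ hħ h0
  have h := quantumImage_phaseShift ħ z k u
  rw [h0, zero_apply] at h
  have h' := (schrodinger n ħ).norm_op (phaseShift ħ z) ((normConst n : ℂ) •
    ∫ g, (k g * character z g) • (schrodinger n ħ).op g u)
  rw [← h, norm_zero] at h'
  exact hħ (norm_eq_zero.1 h'.symm)

/-! ### Limits in the Jacobson topologies -/

theorem tendsto_quantum (z : Phase n) :
    Tendsto (Dual.quantum (n := n)) planckZero (𝓝 (Dual.classical z)) := by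
  refine TopologicalSpace.tendsto_nhds_generateFrom_iff.2 ?_
  rintro _ ⟨k, rfl⟩ hz
  exact eventually_quantumImage_ne_zero hz

/-- A subbasic neighbourhood of the limit excludes the graph of some `k` with `π_z(k) ≠ π_z(b)`.
Avoiding that graph means `π_ħ(b - k) ≠ 0`, which is the non-vanishing result for `b - k`. -/
theorem tendsto_value (b : Kernel n) (z : Phase n) :
    Tendsto (fun ħ => Value.quantum ħ (quantumImage ħ b)) planckZero
      (𝓝 (Value.classical z (classicalImage b z))) := by
  refine TopologicalSpace.tendsto_nhds_generateFrom_iff.2 ?_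
  rintro _ ⟨k, rfl⟩ hz
  have hz' : classicalImage (b - k) z ≠ 0 := by
    rw [classicalImage_sub]
    exact sub_ne_zero.2 hz
  filter_upwards [eventually_quantumImage_ne_zero hz'] with ħ hħ
  rw [quantumImage, UnitaryRep.integrated_sub] at hħ
  exact sub_ne_zero.1 hħ

theorem isClosed_graph (b : Kernel n) : IsClosed (graph b) :=
  ⟨TopologicalSpace.isOpen_generateFrom_of_mem ⟨b, rfl⟩⟩

theorem mem_closure_image_of_tendsto {X : Type*} [TopologicalSpace X] {f : Planck → X} {x : X}
    (hf : Tendsto f planckZero (𝓝 x)) {S : Set Planck} (hS : (planckZero ⊓ 𝓟 S).NeBot) :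
    x ∈ closure (f '' S) :=
  mem_closure_of_tendsto (hf.mono_left inf_le_left)
    (eventually_inf_principal.2 (.of_forall fun _ h => Set.mem_image_of_mem f h))

/-! ### Approaching zero from either side -/

theorem exists_mem_planckZero {s : Set Planck} (hs : s ∈ planckZero) :
    ∃ δ > 0, ∀ ħ : Planck, |ħ.1| < δ → ħ ∈ s := by
  obtain ⟨t, ht, hts⟩ := mem_comap.1 hs
  obtain ⟨δ, hδ, hball⟩ := Metric.mem_nhds_iff.1 ht
  exact ⟨δ, hδ, fun ħ hħ => hts (hball (by simpa using hħ))⟩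

theorem neBot_posPlanck {ε : ℝ} (hε : 0 < ε) : (planckZero ⊓ 𝓟 (posPlanck ε)).NeBot := by
  refine inf_principal_neBot_iff.2 fun s hs => ?_
  obtain ⟨δ, hδ, h⟩ := exists_mem_planckZero hs
  -- Half of `δ` is taken because membership in `s` needs a strict bound, whereas `ε` itself is
  -- allowed.
  have hm : 0 < min ε (δ / 2) := lt_min hε (half_pos hδ)
  refine ⟨⟨min ε (δ / 2), hm.ne'⟩, h _ ?_, hm, min_le_left _ _⟩
  rw [abs_of_pos hm]
  exact (min_le_right _ _).trans_lt (half_lt_self hδ)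

theorem neBot_negPlanck {ε : ℝ} (hε : 0 < ε) : (planckZero ⊓ 𝓟 (negPlanck ε)).NeBot := by
  refine inf_principal_neBot_iff.2 fun s hs => ?_
  obtain ⟨δ, hδ, h⟩ := exists_mem_planckZero hs
  have hm : 0 < min ε (δ / 2) := lt_min hε (half_pos hδ)
  refine ⟨⟨-min ε (δ / 2), neg_ne_zero.2 hm.ne'⟩, h _ ?_, neg_le_neg (min_le_left _ _),
    neg_lt_zero.2 hm⟩
  rw [abs_neg, abs_of_pos hm]
  exact (min_le_right _ _).trans_lt (half_lt_self hδ)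

theorem isJacobsonLimit_quantumImage {S : ℝ → Set Planck}
    (hS : ∀ ε > 0, (planckZero ⊓ 𝓟 (S ε)).NeBot) (b : Kernel n) :
    IsJacobsonLimit S (fun ħ => quantumImage ħ b) (classicalImage b) := by
  refine fun z c => ⟨fun h => ?_, ?_⟩
  -- A single value of `ε` suffices for uniqueness, since all the operators lie in the closed graph
  -- of `b`.
  · refine closure_minimal (t := graph b) ?_ (isClosed_graph b) (h 1 one_pos)
    rintro _ ⟨ħ, _, rfl⟩
    rfl
  · rintro rfl ε hε
    exact mem_closure_image_of_tendsto (tendsto_value b z) (hS ε hε)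

end Limit

end PlainMechanics

end

theorem mainTheorem1 (n : ℕ) (k₁ k₂ : PlainMechanics.Kernel n)
    (hk₁ : MeasureTheory.Integrable
      (fun g : PlainMechanics.Heis n => (‖g.2.1‖ + ‖g.2.2‖) * ‖k₁ g‖) MeasureTheory.volume)
    (hk₂ : MeasureTheory.Integrable
      (fun g : PlainMechanics.Heis n => (‖g.2.1‖ + ‖g.2.2‖) * ‖k₂ g‖) MeasureTheory.volume) :
    ContDiff ℝ 1 (PlainMechanics.classicalImage k₁) ∧
    ContDiff ℝ 1 (PlainMechanics.classicalImage k₂) ∧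
    -- the commutator `[K₁, K₂]` is the convolution with a kernel `c ∈ L¹`
    ∃ c : PlainMechanics.Kernel n,
      c =ᵐ[MeasureTheory.volume] PlainMechanics.commKernel k₁ k₂ ∧
      PlainMechanics.leftConv c =
        PlainMechanics.leftConv k₁ * PlainMechanics.leftConv k₂
          - PlainMechanics.leftConv k₂ * PlainMechanics.leftConv k₁ ∧
      PlainMechanics.rightConv c =
        PlainMechanics.rightConv k₁ * PlainMechanics.rightConv k₂
          - PlainMechanics.rightConv k₂ * PlainMechanics.rightConv k₁ ∧
      -- the operators `(i/ħ) π_ħ([K₁, K₂])` are the images of one convolution, whose image on the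
      -- phase space is the Poisson bracket
      (∃ b : PlainMechanics.Kernel n,
        (∀ ħ : PlainMechanics.Planck, PlainMechanics.quantumImage ħ b =
          (Complex.I / (ħ.1 : ℂ)) • PlainMechanics.quantumImage ħ c) ∧
        PlainMechanics.classicalImage b =
          PlainMechanics.poisson (PlainMechanics.classicalImage k₁)
            (PlainMechanics.classicalImage k₂)) ∧
      -- each point of the phase space is a limit of the representations `π_ħ`
      (∀ z : PlainMechanics.Phase n, ∀ ε > 0,
        PlainMechanics.Dual.classical z ∈
          closure (PlainMechanics.Dual.quantum '' PlainMechanics.posPlanck ε) ∧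
        PlainMechanics.Dual.classical z ∈
          closure (PlainMechanics.Dual.quantum '' PlainMechanics.negPlanck ε)) ∧
      -- the limits as `ħ → 0+` and as `ħ → 0-`
      PlainMechanics.IsJacobsonLimit PlainMechanics.posPlanck
        (fun ħ => (Complex.I / (ħ.1 : ℂ)) • PlainMechanics.quantumImage ħ c)
        (PlainMechanics.poisson (PlainMechanics.classicalImage k₁)
          (PlainMechanics.classicalImage k₂)) ∧
      PlainMechanics.IsJacobsonLimit PlainMechanics.negPlanck
        (fun ħ => (Complex.I / (ħ.1 : ℂ)) • PlainMechanics.quantumImage ħ c)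
        (PlainMechanics.poisson (PlainMechanics.classicalImage k₁)
          (PlainMechanics.classicalImage k₂)) := by
  have hquant := PlainMechanics.quantumImage_dividedKernel hk₁ hk₂
  have hclass := PlainMechanics.classicalImage_dividedKernel hk₁ hk₂
  have hlim : ∀ S : ℝ → Set PlainMechanics.Planck,
      (∀ ε > 0, (PlainMechanics.planckZero ⊓ Filter.principal (S ε)).NeBot) →
      PlainMechanics.IsJacobsonLimit S
        (fun ħ => (Complex.I / (ħ.1 : ℂ)) •
          PlainMechanics.quantumImage ħ (PlainMechanics.commutatorKernel k₁ k₂))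
        (PlainMechanics.poisson (PlainMechanics.classicalImage k₁)
          (PlainMechanics.classicalImage k₂)) := fun S hS => by
    -- The divided commutators are the images of one kernel, so the limit of a single convolution
    -- applies from both sides.
    have h := PlainMechanics.isJacobsonLimit_quantumImage hS
      (PlainMechanics.dividedKernel hk₁ hk₂)
    simpa only [hquant, hclass] using h
  exact ⟨PlainMechanics.contDiff_classicalImage hk₁, PlainMechanics.contDiff_classicalImage hk₂,
    PlainMechanics.commutatorKernel k₁ k₂, PlainMechanics.coeFn_commutatorKernel k₁ k₂,
    (PlainMechanics.leftRegular n).integrated_commutatorKernel k₁ k₂,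
    (PlainMechanics.rightRegular n).integrated_commutatorKernel k₁ k₂,
    ⟨PlainMechanics.dividedKernel hk₁ hk₂, hquant, hclass⟩,
    fun z ε hε =>
      ⟨PlainMechanics.mem_closure_image_of_tendsto (PlainMechanics.tendsto_quantum z)
        (PlainMechanics.neBot_posPlanck hε),
      PlainMechanics.mem_closure_image_of_tendsto (PlainMechanics.tendsto_quantum z)
        (PlainMechanics.neBot_negPlanck hε)⟩,
    hlim _ fun _ => PlainMechanics.neBot_posPlanck, hlim _ fun _ => PlainMechanics.neBot_negPlanck⟩
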